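/- Let $\mathbb D$ be the open unit disc of $\mathbb C$ and $dA=\frac{dx\,dy}{\pi}$ the normalized area measure on $\mathbb D$. For $0<p<\infty$ the Bergman space $A^p$ consists of the holomorphic functions $f$ on $\mathbb D$ with $\|f\|_{A^p}^p=\int_{\mathbb D}|f|^p\,dA<\infty$. Let $\mu$ be a positive Borel measure on $[0,1)$. For $s>0$, $\mu$ is called an $s$-Carleson measure if there is a constant $C>0$ with $\mu([t,1))\le C(1-t)^s$ for all $0\le t<1$. For $\alpha>-1$ put $$\mathcal I_{\mu_{\alpha+1}}(f)(z)=\int_{[0,1)}\frac{f(t)}{(1-tz)^{\alpha+1}}\,d\mu(t),\qquad z\in\mathbb D,$$ with the principal branch of the power. The operator $\mathcal I_{\mu_{\alpha+1}}:A^p\to A^1$ is called bounded if for every $f\in A^p$ this integral converges absolutely for all $z\in\mathbb D$ and defines a function in $A^1$, and there is a constant $C$ with $\|\mathcal I_{\mu_{\alpha+1}}(f)\|_{A^1}\le C\|f\|_{A^p}$ for all $f\in A^p$. **Theorem 4.1.** Let $\mu$ be a positive Borel measure on $[0,1)$ and let $0<p\le 1$. (a) If $\alpha>1$, then $\mathcal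 I_{\mu_{\alpha+1}}:A^p\to A^1$ is bounded if and only if $\mu$ is a $\left(\frac2p+\alpha-1\right)$-Carleson measure. (b) If $-1<\alpha<1$, then $\mathcal I_{\mu_{\alpha+1}}:A^p\to A^1$ is bounded if and only if $\mu$ is a $\frac2p$-Carleson measure. -/

import Mathlib

open MeasureTheory

noncomputable section

/-- The half-open interval `[0, 1)`, which carries its Borel σ-algebra; "a positive Borel measure
on `[0, 1)`" is a `Measure UnitIco`. -/
abbrev UnitIco : Type := Set.Ico (0 : ℝ) 1

/-- The normalized area measure `dA = dx dy / π` on the open unit disc. -/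
def diskArea : Measure ℂ :=
  ENNReal.ofReal Real.pi⁻¹ • (volume : Measure ℂ).restrict (Metric.ball 0 1)

/-- The Bergman (quasi-)norm `‖f‖_{A^p} = (∫_𝔻 |f|^p dA)^{1/p}`, for `0 < p < ∞`, as an extended
non-negative number. -/
def bergmanNorm (p : ℝ) (f : ℂ → ℂ) : ENNReal :=
  eLpNorm f (ENNReal.ofReal p) diskArea

/-- `f` (a function whose values outside the unit disc are ignored) belongs to the Bergman space
`A^p`: it is holomorphic in the open unit disc and `∫_𝔻 |f|^p dA < ∞`. -/
def MemBergman (p : ℝ) (f : ℂ → ℂ) : Prop :=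
  DifferentiableOn ℂ f (Metric.ball 0 1) ∧ bergmanNorm p f < ⊤

/-- The integrand `f(t) / (1 - t z)^{α+1}`. For `z` in the unit disc `1 - t z` has positive real
part, and the power is the principal one. -/
def hilbertIntegrand (α : ℝ) (f : ℂ → ℂ) (z : ℂ) (t : UnitIco) : ℂ :=
  f ((t : ℝ) : ℂ) / (1 - ((t : ℝ) : ℂ) * z) ^ ((α + 1 : ℝ) : ℂ)

/-- The integral type Hilbert operator
`I_{μ_{α+1}}(f)(z) = ∫_{[0,1)} f(t) / (1 - t z)^{α+1} dμ(t)`. -/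
def hilbertOp (μ : Measure UnitIco) (α : ℝ) (f : ℂ → ℂ) (z : ℂ) : ℂ :=
  ∫ t, hilbertIntegrand α f z t ∂μ

/-- `I_{μ_{α+1}} : A^p → A^q` is (well defined and) bounded: for every `f ∈ A^p` the defining
integral converges absolutely at every point of the disc, the resulting function is in `A^q`,
and its norm is at most a constant times that of `f`. -/
def HilbertOpBounded (μ : Measure UnitIco) (α p q : ℝ) : Prop :=
  (∀ f : ℂ → ℂ, MemBergman p f →
    (∀ z ∈ Metric.ball (0 : ℂ) 1, Integrable (hilbertIntegrand α f z) μ) ∧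
      MemBergman q (hilbertOp μ α f)) ∧
  ∃ C : NNReal, ∀ f : ℂ → ℂ, MemBergman p f →
    bergmanNorm q (hilbertOp μ α f) ≤ C * bergmanNorm p f

/-- `μ` is an `s`-Carleson measure: `μ([t, 1)) ≤ C (1 - t)^s` for all `0 ≤ t < 1`. In the type
`UnitIco` the set `Set.Ici t` is the interval `[t, 1)`. -/
def IsCarleson (μ : Measure UnitIco) (s : ℝ) : Prop :=
  ∃ C : ℝ, 0 < C ∧ ∀ t : UnitIco, μ (Set.Ici t) ≤ ENNReal.ofReal (C * (1 - (t : ℝ)) ^ s)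

end

/-!
With `e = max (α - 1) 0` and `α ≠ 1`, both parts say that `I_{μ_{α+1}} : A^p → A^1` is bounded iff
`μ` is a `(2/p + e)`-Carleson measure.

*Sufficiency.* The area integral of `‖1 - t z‖ ^ (-(α+1))` over the disc is `O((1-t)^(-e))`
(`exists_lintegral_kernel_le`), because `3 ‖1 - t z‖ ≥ (1 - t) + ‖1 - z‖`; the value `α = 1`, where
a logarithm appears, is excluded. By Tonelli it remains to bound `∫ |f(t)| (1-t)^(-e) dμ(t)` by
`‖f‖_{A^p}` (`exists_lintegral_enorm_mul_le`). Write `|f| = |f|^p |f|^(1-p)`. The first factor is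
bounded by `(1-t)^(-2)` times the integral of `|f|^p` over the disc with centre `t` and radius
`(1-t)/2`, the second by the growth estimate `|f(t)|^p ≤ K (1-t)^(-2) ‖f‖^p`; this is where `p ≤ 1`
is used. After another use of Tonelli, each point `w` of the disc sees only those `t` with `1 - t`
comparable to `1 - Re w`, and the Carleson condition bounds their contribution by a constant.

The sub-mean value inequality for `|f|^p` with `p ≤ 1` (`exists_enorm_rpow_mul_sq_le`) is derived
from the case `p = 1` by evaluating at a maximum point of `|f(z)|^p (R - |z-c|)^2`, which avoids
subharmonicity of `|f|^p`.

*Necessity.* Test on `f_b(z) = (1 - b z)⁻ᵏ` with `k > 2/p`, whose `A^p` norm is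
`O((1-b)^(2/p-k))`. For `0 ≤ c ≤ b` the value `I(f_b)(c)` is at least a constant times
`(1-b)^(-k) (1-c)^(-(α+1)) μ([b,1))`, and at most a constant times `(1-c)^(-2) ‖I(f_b)‖_{A^1}`.
Hence `μ([b,1)) ≤ C (1-b)^(2/p) (1-c)^(α-1)` (`HilbertOpBounded.exists_measure_le`); `c = b` gives
the condition for `α > 1` and `c = 0` the one for `α < 1`.
-/

open MeasureTheory

/-! ### Sub-mean value inequalities for `‖f‖ ^ p` -/

theorem measurable_indicator_of_continuousOn {s : Set ℂ} {f : ℂ → ENNReal} (hf : ContinuousOn f s)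
    (hs : MeasurableSet s) : Measurable (s.indicator f) := by
  classical
  rw [← Set.piecewise_eq_indicator]
  exact hf.measurable_piecewise continuousOn_const hs

/-- The mean value property on circles, phrased over the angular range of polar coordinates. -/
theorem enorm_le_lintegral_circle {f : ℂ → ℂ} {c : ℂ} {R r : ℝ} (hr : 0 < r) (hrR : r < R)
    (hf : DifferentiableOn ℂ f (Metric.ball c R)) :
    ENNReal.ofReal (2 * Real.pi) * ‖f c‖ₑ ≤
      ∫⁻ θ in Set.Ioo (-Real.pi) Real.pi, ‖f (circleMap c r θ)‖ₑ := by
  have hd : DiffContOnCl ℂ f (Metric.ball c |r|) := by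
    rw [abs_of_pos hr]
    apply DifferentiableOn.diffContOnCl
    refine hf.mono ?_
    rw [closure_ball c hr.ne']
    exact Metric.closedBall_subset_ball hrR
  have h := hd.circleAverage
  have hpi := Real.pi_pos
  rw [Real.circleAverage_eq_integral_add (-Real.pi),
    intervalIntegral.integral_comp_add_right (fun θ => f (circleMap c r θ)),
    intervalIntegral.integral_of_le (by linarith)] at h
  have e1 : (0 : ℝ) + -Real.pi = -Real.pi := by ring
  have e2 : 2 * Real.pi + -Real.pi = Real.pi := by ring
  rw [e1, e2, integral_Ioc_eq_integral_Ioo] at h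
  rw [← h, enorm_smul, ← mul_assoc]
  have : ENNReal.ofReal (2 * Real.pi) * ‖(2 * Real.pi)⁻¹‖ₑ = 1 := by
    rw [Real.enorm_of_nonneg (by positivity), ← ENNReal.ofReal_mul (by positivity),
      mul_inv_cancel₀ (by positivity), ENNReal.ofReal_one]
  rw [this, one_mul]
  exact enorm_integral_le_lintegral_enorm _

/-- The area form of the sub-mean value property of `‖f‖`, with a non-optimal constant. -/
theorem enorm_mul_sq_le_lintegral_ball {f : ℂ → ℂ} {c : ℂ} {R : ℝ} (hR : 0 < R)
    (hf : DifferentiableOn ℂ f (Metric.ball c R)) :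
    ‖f c‖ₑ * ENNReal.ofReal (R ^ 2) ≤ ∫⁻ z in Metric.ball c R, ‖f z‖ₑ := by
  have hpi := Real.pi_gt_three
  set g : ℂ → ENNReal := (Metric.ball c R).indicator (fun z => ‖f z‖ₑ) with hg
  have hgm : Measurable g :=
    measurable_indicator_of_continuousOn hf.continuousOn.enorm Metric.isOpen_ball.measurableSet
  rw [← lintegral_indicator Metric.isOpen_ball.measurableSet, ← hg,
    ← lintegral_add_left_eq_self g c, ← Complex.lintegral_comp_polarCoord_symm]
  have htar : polarCoord.target = Set.Ioi (0 : ℝ) ×ˢ Set.Ioo (-Real.pi) Real.pi := rfl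
  have hms : Measurable (Complex.polarCoord.symm : ℝ × ℝ → ℂ) := by
    have : (Complex.polarCoord.symm : ℝ × ℝ → ℂ) =
      fun p => p.1 * (Real.cos p.2 + Real.sin p.2 * Complex.I) := by
      ext p; simp
    rw [this]; fun_prop
  rw [htar, Measure.volume_eq_prod, ← Measure.prod_restrict, lintegral_prod _ (by
    apply Measurable.aemeasurable; simp only [smul_eq_mul]; fun_prop)]
  calc ‖f c‖ₑ * ENNReal.ofReal (R ^ 2)
      ≤ ∫⁻ r in Set.Ioo (R / 2) R, ENNReal.ofReal (R / 2) *
          (ENNReal.ofReal (2 * Real.pi) * ‖f c‖ₑ) := by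
        rw [lintegral_const, Measure.restrict_apply_univ, Real.volume_Ioo, mul_comm,
          mul_assoc (ENNReal.ofReal (R / 2)), mul_right_comm (ENNReal.ofReal (2 * Real.pi)),
          ← mul_assoc, ← ENNReal.ofReal_mul (by positivity), ← ENNReal.ofReal_mul (by positivity)]
        gcongr
        nlinarith [sq_nonneg R]
    _ ≤ ∫⁻ r in Set.Ioo (R / 2) R, ∫⁻ θ in Set.Ioo (-Real.pi) Real.pi,
          ENNReal.ofReal r • g (c + Complex.polarCoord.symm (r, θ)) := by
        refine setLIntegral_mono' measurableSet_Ioo fun r hr => ?_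
        have hr0 : 0 < r := by linarith [hr.1]
        simp only [smul_eq_mul]
        rw [lintegral_const_mul' _ _ ENNReal.ofReal_ne_top]
        gcongr
        · exact hr.1.le
        refine (enorm_le_lintegral_circle hr0 hr.2 hf).trans_eq (lintegral_congr fun θ => ?_)
        have : c + Complex.polarCoord.symm (r, θ) = circleMap c r θ := by
          simp [circleMap, Complex.exp_mul_I]
        rw [this, hg, Set.indicator_of_mem]
        simp [circleMap, abs_of_pos hr0, hr.2]
    _ ≤ _ := by
        refine lintegral_mono_set fun r hr => ?_
        exact lt_trans (by positivity) hr.1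

/-- For `0 < p ≤ 1`, `‖f‖ ^ p` has the sub-mean value property up to a constant. At a point `w` where
`‖f z‖ ^ p * (R - dist z c) ^ 2` is maximal, `‖f‖` is bounded by a multiple of `‖f w‖` on the ball
of half the distance to the boundary, so there the case `p = 1` self-improves. -/
theorem exists_enorm_rpow_mul_sq_le {p : ℝ} (hp0 : 0 < p) (hp1 : p ≤ 1) :
    ∃ K : NNReal, ∀ (f : ℂ → ℂ) (c : ℂ) (R : ℝ), 0 < R →
      ContinuousOn f (Metric.closedBall c R) → DifferentiableOn ℂ f (Metric.ball c R) →
      ‖f c‖ₑ ^ p * ENNReal.ofReal (R ^ 2) ≤ K * ∫⁻ z in Metric.ball c R, ‖f z‖ₑ ^ p := by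
  refine ⟨4 * ((4 : NNReal) ^ (1 / p)) ^ (1 - p), fun f c R hR hcont hdiff => ?_⟩
  -- the weighted supremum is attained at an interior point `w`
  obtain ⟨w, hw, hmax⟩ := (isCompact_closedBall c R).exists_isMaxOn
    ⟨c, Metric.mem_closedBall_self hR.le⟩
    (f := fun z => ‖f z‖ ^ p * (R - dist z c) ^ 2)
    ((hcont.norm.rpow_const fun _ _ => Or.inr hp0.le).mul (by fun_prop))
  rw [isMaxOn_iff] at hmax
  rw [Metric.mem_closedBall] at hw
  by_cases hfc : f c = 0
  · simp [hfc, hp0]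
  set d := R - dist w c with hd
  have hcR : 0 < ‖f c‖ ^ p * R ^ 2 := by positivity
  have hcw : ‖f c‖ ^ p * R ^ 2 ≤ ‖f w‖ ^ p * d ^ 2 := by
    simpa using hmax c (Metric.mem_closedBall_self hR.le)
  have hd0 : 0 < d := by
    have : 0 ≤ d := by linarith
    rcases this.eq_or_lt with h | h
    · rw [← h] at hcw; simp at hcw; linarith
    · exact h
  have hfw : 0 < ‖f w‖ := by
    rcases (norm_nonneg (f w)).eq_or_lt with h | h
    · rw [← h, Real.zero_rpow hp0.ne'] at hcw; linarith
    · exact h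
  have hsub : Metric.ball w (d / 2) ⊆ Metric.ball c R := by
    apply Metric.ball_subset_ball'; linarith
  have hbound : ∀ z ∈ Metric.ball w (d / 2), ‖f z‖ₑ ≤ (4 : ENNReal) ^ (1 / p) * ‖f w‖ₑ := by
    intro z hz
    have h1 := hmax z (Metric.ball_subset_closedBall (hsub hz))
    have h2 : d / 2 ≤ R - dist z c := by
      have := dist_triangle z w c
      rw [Metric.mem_ball] at hz
      linarith
    have h3 : ‖f z‖ ^ p ≤ 4 * ‖f w‖ ^ p := by
      have : ‖f z‖ ^ p * (d / 2) ^ 2 ≤ ‖f w‖ ^ p * d ^ 2 := le_trans (by gcongr) h1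
      have h5 : 0 < d ^ 2 := by positivity
      nlinarith
    have h4 : ‖f z‖ ≤ 4 ^ (1 / p) * ‖f w‖ := by
      rw [← Real.rpow_le_rpow_iff (by positivity) (by positivity) hp0,
        Real.mul_rpow (by positivity) (by positivity), ← Real.rpow_mul (by norm_num),
        one_div_mul_cancel hp0.ne', Real.rpow_one]
      exact h3
    rw [← ofReal_norm, ← ofReal_norm]
    refine (ENNReal.ofReal_le_ofReal h4).trans_eq ?_
    rw [ENNReal.ofReal_mul (by positivity), ← ENNReal.ofReal_rpow_of_pos (by norm_num)]
    simp
  set A := ‖f w‖ₑ with hA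
  set J := ∫⁻ z in Metric.ball c R, ‖f z‖ₑ ^ p
  set B := ((4 : ENNReal) ^ (1 / p)) ^ (1 - p) with hB
  have hp1' : 0 ≤ 1 - p := by linarith
  -- the mean value inequality at `w`, with `‖f z‖ = ‖f z‖ ^ (1 - p) * ‖f z‖ ^ p`
  have key : A * ENNReal.ofReal ((d / 2) ^ 2) ≤ B * A ^ (1 - p) * J := by
    calc A * ENNReal.ofReal ((d / 2) ^ 2) ≤ ∫⁻ z in Metric.ball w (d / 2), ‖f z‖ₑ :=
          enorm_mul_sq_le_lintegral_ball (by positivity) (hdiff.mono hsub)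
      _ ≤ ∫⁻ z in Metric.ball w (d / 2), B * A ^ (1 - p) * ‖f z‖ₑ ^ p := by
          refine setLIntegral_mono' Metric.isOpen_ball.measurableSet fun z hz => ?_
          calc ‖f z‖ₑ = ‖f z‖ₑ ^ (1 - p) * ‖f z‖ₑ ^ p := by
                rw [← ENNReal.rpow_add_of_nonneg _ _ hp1' hp0.le]; simp
            _ ≤ ((4 : ENNReal) ^ (1 / p) * A) ^ (1 - p) * ‖f z‖ₑ ^ p := by
                gcongr; exact hbound z hz
            _ = _ := by rw [ENNReal.mul_rpow_of_nonneg _ _ hp1']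
      _ ≤ ∫⁻ z in Metric.ball c R, B * A ^ (1 - p) * ‖f z‖ₑ ^ p := lintegral_mono_set hsub
      _ = B * A ^ (1 - p) * J := by
          rw [lintegral_const_mul']
          finiteness
  have hA0 : A ≠ 0 := by simp [hA, norm_pos_iff.1 hfw]
  have hAt : A ≠ ⊤ := by simp [hA]
  -- divide by `A ^ (1 - p)`, which is neither zero nor infinite
  have key2 : A ^ p * ENNReal.ofReal (d ^ 2) ≤ 4 * B * J := by
    have h0 : A ^ (1 - p) ≠ 0 := by simp [hA0, hAt]
    have ht : A ^ (1 - p) ≠ ⊤ := by finiteness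
    rw [← ENNReal.mul_le_mul_iff_right h0 ht]
    have e1 : A ^ (1 - p) * (A ^ p * ENNReal.ofReal (d ^ 2)) =
        4 * (A * ENNReal.ofReal ((d / 2) ^ 2)) := by
      rw [← mul_assoc, ← ENNReal.rpow_add_of_nonneg _ _ hp1' hp0.le]
      have : d ^ 2 = 4 * (d / 2) ^ 2 := by ring
      rw [this, ENNReal.ofReal_mul (by norm_num)]
      simp
      ring
    rw [e1]
    calc 4 * (A * ENNReal.ofReal ((d / 2) ^ 2)) ≤ 4 * (B * A ^ (1 - p) * J) := by gcongr
      _ = _ := by ring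
  have e3 : ‖f c‖ₑ ^ p * ENNReal.ofReal (R ^ 2) ≤ A ^ p * ENNReal.ofReal (d ^ 2) := by
    rw [hA, ← ofReal_norm, ← ofReal_norm, ENNReal.ofReal_rpow_of_nonneg
      (norm_nonneg _) hp0.le, ENNReal.ofReal_rpow_of_nonneg (norm_nonneg _) hp0.le,
      ← ENNReal.ofReal_mul (by positivity), ← ENNReal.ofReal_mul (by positivity)]
    exact ENNReal.ofReal_le_ofReal hcw
  refine e3.trans (key2.trans_eq ?_)
  congr 1
  rw [hB, ENNReal.coe_mul, ENNReal.coe_rpow_of_nonneg _ hp1', ENNReal.coe_rpow_of_nonneg _ (by positivity)]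
  simp

/-! ### Area integrals of the kernel `‖1 - t z‖ ^ (-β)` -/

/-- The kernel `1 - t z` is bounded below by the distance `1 - t` of `t` to the boundary and by
`‖1 - z‖` simultaneously. -/
theorem one_sub_add_norm_le {t : ℝ} (ht0 : 0 ≤ t) (ht1 : t < 1) {z : ℂ} (hz : ‖z‖ ≤ 1) :
    (1 - t) + ‖1 - z‖ ≤ 3 * ‖1 - (t : ℂ) * z‖ := by
  have h1 : 1 - t ≤ ‖1 - (t : ℂ) * z‖ := by
    have := norm_sub_norm_le (1 : ℂ) ((t : ℂ) * z)
    rw [norm_one, norm_mul, Complex.norm_real, Real.norm_of_nonneg ht0] at this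
    nlinarith [norm_nonneg z]
  have h2 : ‖1 - z‖ ≤ ‖1 - (t : ℂ) * z‖ + (1 - t) * ‖z‖ := by
    have e : 1 - z = (1 - (t : ℂ) * z) + ((t - 1 : ℝ) : ℂ) * z := by push_cast; ring
    have e2 : ‖((t - 1 : ℝ) : ℂ)‖ = 1 - t := by
      rw [Complex.norm_real, Real.norm_eq_abs, abs_sub_comm, abs_of_pos (by linarith)]
    calc ‖1 - z‖ = ‖(1 - (t : ℂ) * z) + ((t - 1 : ℝ) : ℂ) * z‖ := by rw [← e]
      _ ≤ _ := (norm_add_le _ _).trans_eq (by rw [norm_mul, e2])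
  nlinarith [norm_nonneg z]

theorem rpow_neg_le_of_le_three_mul {x y β : ℝ} (hβ : 0 ≤ β) (hx : 0 < x) (h : x ≤ 3 * y) :
    y ^ (-β) ≤ 3 ^ β * x ^ (-β) := by
  have hy : 0 < y := by linarith
  have : (3 * y) ^ (-β) ≤ x ^ (-β) := Real.rpow_le_rpow_of_nonpos hx h (by linarith)
  rw [Real.mul_rpow (by norm_num) hy.le, Real.rpow_neg (by norm_num)] at this
  have h3 : (0 : ℝ) < 3 ^ β := by positivity
  calc y ^ (-β) = 3 ^ β * ((3 ^ β)⁻¹ * y ^ (-β)) := by field_simp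
    _ ≤ _ := by gcongr

/-- Homogeneity of the Japanese bracket integral over the plane, from the substitution `w = δ u`. -/
theorem lintegral_add_norm_rpow_neg {δ : ℝ} (hδ : 0 < δ) (β : ℝ) :
    ∫⁻ w : ℂ, ENNReal.ofReal ((δ + ‖w‖) ^ (-β)) =
      ENNReal.ofReal (δ ^ (2 - β)) * ∫⁻ w : ℂ, ENNReal.ofReal ((1 + ‖w‖) ^ (-β)) := by
  have h := Measure.map_addHaar_smul (volume : Measure ℂ) hδ.ne'
  have h2 : ∫⁻ w : ℂ, ENNReal.ofReal ((δ + ‖δ • w‖) ^ (-β)) =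
      ENNReal.ofReal ((δ ^ 2)⁻¹) * ∫⁻ w : ℂ, ENNReal.ofReal ((δ + ‖w‖) ^ (-β)) := by
    rw [Complex.finrank_real_complex, abs_of_pos (by positivity)] at h
    rw [← smul_eq_mul, ← lintegral_smul_measure, ← h,
      lintegral_map (by fun_prop) (measurable_const_smul δ)]
  have h3 : ∀ w : ℂ, ENNReal.ofReal ((δ + ‖δ • w‖) ^ (-β)) =
      ENNReal.ofReal (δ ^ (-β)) * ENNReal.ofReal ((1 + ‖w‖) ^ (-β)) := by
    intro w
    rw [norm_smul, Real.norm_of_nonneg hδ.le, ← ENNReal.ofReal_mul (by positivity),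
      ← Real.mul_rpow hδ.le (by positivity)]
    ring_nf
  simp_rw [h3] at h2
  rw [lintegral_const_mul' _ _ ENNReal.ofReal_ne_top] at h2
  have h4 : ENNReal.ofReal (δ ^ 2) * ENNReal.ofReal ((δ ^ 2)⁻¹) = 1 := by
    rw [← ENNReal.ofReal_mul (by positivity), mul_inv_cancel₀ (by positivity), ENNReal.ofReal_one]
  rw [← one_mul (∫⁻ w : ℂ, ENNReal.ofReal ((δ + ‖w‖) ^ (-β))), ← h4, mul_assoc, ← h2, ← mul_assoc,
    ← ENNReal.ofReal_mul (by positivity), ← Real.rpow_natCast, ← Real.rpow_add hδ]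
  rfl

theorem lintegral_diskArea (g : ℂ → ENNReal) :
    ∫⁻ z, g z ∂diskArea = ENNReal.ofReal Real.pi⁻¹ * ∫⁻ z in Metric.ball 0 1, g z := by
  rw [diskArea, lintegral_smul_measure, smul_eq_mul]

theorem lintegral_diskArea_le (g : ℂ → ENNReal) :
    ∫⁻ z, g z ∂diskArea ≤ ∫⁻ z in Metric.ball 0 1, g z := by
  rw [lintegral_diskArea]
  refine mul_le_of_le_one_left' ?_
  rw [ENNReal.ofReal_le_one]
  exact inv_le_one_of_one_le₀ (by linarith [Real.pi_gt_three])

theorem exists_lintegral_kernel_le_of_two_lt {β : ℝ} (hβ : 2 < β) :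
    ∃ C : NNReal, ∀ t : ℝ, 0 ≤ t → t < 1 →
      ∫⁻ z, ENNReal.ofReal (‖1 - (t : ℂ) * z‖ ^ (-β)) ∂diskArea ≤
        C * ENNReal.ofReal ((1 - t) ^ (2 - β)) := by
  have hfin : ∫⁻ w : ℂ, ENNReal.ofReal ((1 + ‖w‖) ^ (-β)) < ⊤ :=
    finite_integral_one_add_norm (by rw [Complex.finrank_real_complex]; exact_mod_cast hβ)
  refine ⟨(ENNReal.ofReal (3 ^ β) * ∫⁻ w : ℂ, ENNReal.ofReal ((1 + ‖w‖) ^ (-β))).toNNReal,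
    fun t ht0 ht1 => ?_⟩
  rw [ENNReal.coe_toNNReal (by finiteness)]
  have hδ : 0 < 1 - t := by linarith
  calc ∫⁻ z, ENNReal.ofReal (‖1 - (t : ℂ) * z‖ ^ (-β)) ∂diskArea
      ≤ ∫⁻ z in Metric.ball 0 1, ENNReal.ofReal (‖1 - (t : ℂ) * z‖ ^ (-β)) :=
        lintegral_diskArea_le _
    _ ≤ ∫⁻ z in Metric.ball (0 : ℂ) 1, ENNReal.ofReal (3 ^ β) *
          ENNReal.ofReal (((1 - t) + ‖1 - z‖) ^ (-β)) := by
        refine setLIntegral_mono' Metric.isOpen_ball.measurableSet fun z hz => ?_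
        rw [← ENNReal.ofReal_mul (by positivity)]
        exact ENNReal.ofReal_le_ofReal (rpow_neg_le_of_le_three_mul (by linarith) (by positivity)
          (one_sub_add_norm_le ht0 ht1 (mem_ball_zero_iff.1 hz).le))
    _ ≤ ∫⁻ z : ℂ, ENNReal.ofReal (3 ^ β) * ENNReal.ofReal (((1 - t) + ‖1 - z‖) ^ (-β)) :=
        setLIntegral_le_lintegral _ _
    _ = _ := by
        rw [lintegral_const_mul' _ _ ENNReal.ofReal_ne_top,
          lintegral_sub_left_eq_self
            (fun w : ℂ => ENNReal.ofReal (((1 - t) + ‖w‖) ^ (-β))) 1,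
          lintegral_add_norm_rpow_neg hδ, mul_left_comm, mul_comm]

theorem exists_lintegral_kernel_le_of_lt_two {β : ℝ} (hβ0 : 0 ≤ β) (hβ : β < 2) :
    ∃ C : NNReal, ∀ t : ℝ, 0 ≤ t → t < 1 →
      ∫⁻ z, ENNReal.ofReal (‖1 - (t : ℂ) * z‖ ^ (-β)) ∂diskArea ≤ C := by
  -- `1 - z` ranges over a subset of the ball of radius `2`
  have hfin : ∫⁻ w : ℂ in Metric.ball 0 2, ENNReal.ofReal (‖w‖ ^ (-β)) < ⊤ := by
    have := integrableOn_ball_of_norm_le_rpow (μ := (volume : Measure ℂ)) (C := 1) (α := β) (r := 2)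
      (f := fun w : ℂ => ‖w‖ ^ (-β)) (by simp [Complex.finrank_real_complex])
      (by rw [Complex.finrank_real_complex]; exact_mod_cast hβ)
      (Filter.Eventually.of_forall fun x => by
        rw [Real.norm_of_nonneg (by positivity), one_mul])
      (by apply Measurable.aestronglyMeasurable; fun_prop)
    refine lt_of_le_of_lt (le_of_eq ?_) this.2
    refine lintegral_congr fun w => ?_
    rw [Real.enorm_of_nonneg (by positivity)]
  refine ⟨(ENNReal.ofReal (3 ^ β) *
    ∫⁻ w : ℂ in Metric.ball 0 2, ENNReal.ofReal (‖w‖ ^ (-β))).toNNReal, fun t ht0 ht1 => ?_⟩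
  rw [ENNReal.coe_toNNReal (by finiteness)]
  set g : ℂ → ENNReal := (Metric.ball (0 : ℂ) 2).indicator
    (fun w => ENNReal.ofReal (‖w‖ ^ (-β))) with hg
  calc ∫⁻ z, ENNReal.ofReal (‖1 - (t : ℂ) * z‖ ^ (-β)) ∂diskArea
      ≤ ∫⁻ z in Metric.ball 0 1, ENNReal.ofReal (‖1 - (t : ℂ) * z‖ ^ (-β)) :=
        lintegral_diskArea_le _
    _ ≤ ∫⁻ z in Metric.ball 0 1, ENNReal.ofReal (3 ^ β) * g (1 - z) := by
        refine setLIntegral_mono' Metric.isOpen_ball.measurableSet fun z hz => ?_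
        rw [mem_ball_zero_iff] at hz
        have h1 : 0 < ‖1 - z‖ := by
          rw [norm_pos_iff, sub_ne_zero]
          rintro rfl
          simp at hz
        have h2 : 1 - z ∈ Metric.ball (0 : ℂ) 2 := by
          rw [mem_ball_zero_iff]
          have := norm_sub_le (1 : ℂ) z
          rw [norm_one] at this
          linarith
        rw [hg, Set.indicator_of_mem h2, ← ENNReal.ofReal_mul (by positivity)]
        refine ENNReal.ofReal_le_ofReal (rpow_neg_le_of_le_three_mul hβ0 h1 ?_)
        linarith [one_sub_add_norm_le ht0 ht1 hz.le]
    _ ≤ ∫⁻ z, ENNReal.ofReal (3 ^ β) * g (1 - z) := setLIntegral_le_lintegral _ _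
    _ = _ := by
        rw [lintegral_const_mul' _ _ ENNReal.ofReal_ne_top, lintegral_sub_left_eq_self g 1,
          hg, lintegral_indicator Metric.isOpen_ball.measurableSet]

/-- The two regimes of the kernel integral; at `α = 1` it grows logarithmically. -/
theorem exists_lintegral_kernel_le {α : ℝ} (hα : -1 < α) (hα1 : α ≠ 1) :
    ∃ C : NNReal, ∀ t : ℝ, 0 ≤ t → t < 1 →
      ∫⁻ z, ENNReal.ofReal (‖1 - (t : ℂ) * z‖ ^ (-(α + 1))) ∂diskArea ≤
        C * ENNReal.ofReal ((1 - t) ^ (-max (α - 1) 0)) := by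
  rcases lt_or_gt_of_ne hα1 with h | h
  · obtain ⟨C, hC⟩ := exists_lintegral_kernel_le_of_lt_two (β := α + 1) (by linarith) (by linarith)
    refine ⟨C, fun t ht0 ht1 => ?_⟩
    rw [max_eq_right (by linarith)]
    simpa using hC t ht0 ht1
  · obtain ⟨C, hC⟩ := exists_lintegral_kernel_le_of_two_lt (β := α + 1) (by linarith)
    refine ⟨C, fun t ht0 ht1 => ?_⟩
    rw [max_eq_left (by linarith), show -(α - 1) = 2 - (α + 1) by ring]
    exact hC t ht0 ht1

/-! ### Growth of Bergman functions and the Carleson embedding -/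

theorem bergmanNorm_eq {p : ℝ} (hp : 0 < p) (f : ℂ → ℂ) :
    bergmanNorm p f = (∫⁻ z, ‖f z‖ₑ ^ p ∂diskArea) ^ (1 / p) := by
  rw [bergmanNorm, eLpNorm_eq_lintegral_rpow_enorm_toReal (by simpa using hp) ENNReal.ofReal_ne_top,
    ENNReal.toReal_ofReal hp.le]

theorem bergmanNorm_one (f : ℂ → ℂ) : bergmanNorm 1 f = ∫⁻ z, ‖f z‖ₑ ∂diskArea := by
  simp [bergmanNorm_eq one_pos]

theorem lintegral_ball_eq (g : ℂ → ENNReal) :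
    ∫⁻ z in Metric.ball 0 1, g z = ENNReal.ofReal Real.pi * ∫⁻ z, g z ∂diskArea := by
  rw [lintegral_diskArea, ← mul_assoc, ← ENNReal.ofReal_mul Real.pi_pos.le,
    mul_inv_cancel₀ Real.pi_ne_zero, ENNReal.ofReal_one, one_mul]

theorem exists_enorm_rpow_le_lintegral_ball {p : ℝ} (hp0 : 0 < p) (hp1 : p ≤ 1) :
    ∃ K : NNReal, ∀ f : ℂ → ℂ, DifferentiableOn ℂ f (Metric.ball 0 1) →
      ∀ t : ℝ, 0 ≤ t → t < 1 → ‖f t‖ₑ ^ p ≤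
        K * ENNReal.ofReal ((1 - t) ^ (-2 : ℝ)) *
          ∫⁻ z in Metric.ball (t : ℂ) ((1 - t) / 2), ‖f z‖ₑ ^ p := by
  obtain ⟨K, hK⟩ := exists_enorm_rpow_mul_sq_le hp0 hp1
  refine ⟨4 * K, fun f hf t ht0 ht1 => ?_⟩
  have hδ : 0 < 1 - t := by linarith
  have hsub : Metric.closedBall (t : ℂ) ((1 - t) / 2) ⊆ Metric.ball 0 1 := by
    apply Metric.closedBall_subset_ball'
    rw [dist_zero_right, Complex.norm_real, Real.norm_of_nonneg ht0]
    linarith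
  have h := hK f t ((1 - t) / 2) (by linarith) (hf.continuousOn.mono hsub)
    (hf.mono (Metric.ball_subset_closedBall.trans hsub))
  have e : ENNReal.ofReal (((1 - t) / 2) ^ 2) * (4 * ENNReal.ofReal ((1 - t) ^ (-2 : ℝ))) = 1 := by
    rw [show (4 : ENNReal) = ENNReal.ofReal 4 by simp, ← ENNReal.ofReal_mul (by norm_num),
      ← ENNReal.ofReal_mul (by positivity), ENNReal.ofReal_eq_one, Real.rpow_neg hδ.le,
      Real.rpow_two]
    field_simp
    norm_num
  calc ‖f t‖ₑ ^ p = ‖f t‖ₑ ^ p * ENNReal.ofReal (((1 - t) / 2) ^ 2) *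
        (4 * ENNReal.ofReal ((1 - t) ^ (-2 : ℝ))) := by rw [mul_assoc, e, mul_one]
    _ ≤ K * (∫⁻ z in Metric.ball (t : ℂ) ((1 - t) / 2), ‖f z‖ₑ ^ p) *
        (4 * ENNReal.ofReal ((1 - t) ^ (-2 : ℝ))) := by gcongr
    _ = _ := by push_cast; ring

/-- The growth estimate `|f(t)| ^ p ≤ K (1 - t) ^ (-2) ‖f‖ ^ p` on the radius `[0, 1)`. -/
theorem exists_enorm_rpow_le {p : ℝ} (hp0 : 0 < p) (hp1 : p ≤ 1) :
    ∃ K : NNReal, ∀ f : ℂ → ℂ, DifferentiableOn ℂ f (Metric.ball 0 1) →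
      ∀ t : ℝ, 0 ≤ t → t < 1 → ‖f t‖ₑ ^ p ≤
        K * ENNReal.ofReal ((1 - t) ^ (-2 : ℝ)) * ∫⁻ z, ‖f z‖ₑ ^ p ∂diskArea := by
  obtain ⟨K, hK⟩ := exists_enorm_rpow_le_lintegral_ball hp0 hp1
  refine ⟨K * Real.pi.toNNReal, fun f hf t ht0 ht1 => ?_⟩
  have hsub : Metric.ball (t : ℂ) ((1 - t) / 2) ⊆ Metric.ball 0 1 := by
    apply Metric.ball_subset_ball'
    rw [dist_zero_right, Complex.norm_real, Real.norm_of_nonneg ht0]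
    linarith
  calc ‖f t‖ₑ ^ p ≤ K * ENNReal.ofReal ((1 - t) ^ (-2 : ℝ)) *
          ∫⁻ z in Metric.ball (t : ℂ) ((1 - t) / 2), ‖f z‖ₑ ^ p := hK f hf t ht0 ht1
    _ ≤ K * ENNReal.ofReal ((1 - t) ^ (-2 : ℝ)) * ∫⁻ z in Metric.ball 0 1, ‖f z‖ₑ ^ p := by
        gcongr
    _ = _ := by
        rw [lintegral_ball_eq, ENNReal.coe_mul, ENNReal.ofReal_eq_coe_nnreal Real.pi_pos.le,
          Real.toNNReal_of_nonneg Real.pi_pos.le]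
        ring

/-- The Carleson condition as a bound on `{t | 1 - t ≤ y}`, for all `y > 0` including `y ≥ 1`. -/
theorem measure_one_sub_le {μ : Measure UnitIco} {s C : ℝ} (hs : 0 ≤ s) (hC : 0 < C)
    (h : ∀ t : UnitIco, μ (Set.Ici t) ≤ ENNReal.ofReal (C * (1 - (t : ℝ)) ^ s)) {y : ℝ}
    (hy : 0 < y) : μ {t : UnitIco | 1 - (t : ℝ) ≤ y} ≤ ENNReal.ofReal (C * y ^ s) := by
  rcases lt_or_ge y 1 with h1 | h1
  · refine (measure_mono fun t ht => ?_).trans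
      ((h ⟨1 - y, by constructor <;> linarith⟩).trans_eq (by simp))
    rw [Set.mem_Ici, ← Subtype.coe_le_coe]
    have : 1 - (t : ℝ) ≤ y := ht
    simp only
    linarith
  · refine (measure_mono fun t _ => ?_).trans ((h ⟨0, by simp⟩).trans ?_)
    · rw [Set.mem_Ici, ← Subtype.coe_le_coe]
      exact t.2.1
    · apply ENNReal.ofReal_le_ofReal
      gcongr
      simpa using h1

theorem IsCarleson.isFiniteMeasure {μ : Measure UnitIco} {s : ℝ} (h : IsCarleson μ s) :
    IsFiniteMeasure μ := by
  obtain ⟨C, -, hC⟩ := h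
  refine ⟨(measure_mono fun t _ => ?_).trans_lt
    ((hC ⟨0, by simp⟩).trans_lt ENNReal.ofReal_lt_top)⟩
  rw [Set.mem_Ici, ← Subtype.coe_le_coe]
  exact t.2.1

/-- The points `t` whose disc of radius `(1 - t) / 2` contains a given `w` all satisfy
`1 - t ≈ 1 - Re w`, so the Carleson condition bounds the integral uniformly in `w`. -/
theorem lintegral_rpow_neg_tent_le {μ : Measure UnitIco} {s C : ℝ} (hs : 0 ≤ s) (hC : 0 < C)
    (h : ∀ t : UnitIco, μ (Set.Ici t) ≤ ENNReal.ofReal (C * (1 - (t : ℝ)) ^ s)) {w : ℂ}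
    (hw : ‖w‖ < 1) :
    ∫⁻ t : UnitIco in {t : UnitIco | dist w ((t : ℝ) : ℂ) < (1 - (t : ℝ)) / 2},
      ENNReal.ofReal ((1 - (t : ℝ)) ^ (-s)) ∂μ ≤ ENNReal.ofReal (C * 3 ^ s) := by
  set x := 1 - w.re with hx
  have hx0 : 0 < x := by linarith [(Complex.re_le_norm w)]
  have hmem : ∀ t ∈ {t : UnitIco | dist w ((t : ℝ) : ℂ) < (1 - (t : ℝ)) / 2},
      2 / 3 * x ≤ 1 - (t : ℝ) ∧ 1 - (t : ℝ) ≤ 2 * x := by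
    intro t ht
    have h1 : |w.re - t| < (1 - (t : ℝ)) / 2 := by
      refine lt_of_le_of_lt ?_ ht
      have := Complex.abs_re_le_norm (w - ((t : ℝ) : ℂ))
      rw [dist_eq_norm]
      simpa using this
    rw [abs_lt] at h1
    constructor <;> linarith [h1.1, h1.2]
  have hmeas : MeasurableSet {t : UnitIco | dist w ((t : ℝ) : ℂ) < (1 - (t : ℝ)) / 2} :=
    measurableSet_lt (by fun_prop) (by fun_prop)
  calc _ ≤ ∫⁻ t : UnitIco in {t : UnitIco | dist w ((t : ℝ) : ℂ) < (1 - (t : ℝ)) / 2},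
        ENNReal.ofReal ((2 / 3 * x) ^ (-s)) ∂μ := by
        refine setLIntegral_mono' hmeas fun t ht => ENNReal.ofReal_le_ofReal ?_
        exact Real.rpow_le_rpow_of_nonpos (by positivity) (hmem t ht).1 (by linarith)
    _ = ENNReal.ofReal ((2 / 3 * x) ^ (-s)) *
        μ {t : UnitIco | dist w ((t : ℝ) : ℂ) < (1 - (t : ℝ)) / 2} := by
        rw [setLIntegral_const]
    _ ≤ ENNReal.ofReal ((2 / 3 * x) ^ (-s)) * ENNReal.ofReal (C * (2 * x) ^ s) := by
        gcongr
        exact (measure_mono fun t ht => (hmem t ht).2).trans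
          (measure_one_sub_le hs hC h (by positivity))
    _ = _ := by
        have hu : 0 < 2 / 3 * x := by positivity
        rw [← ENNReal.ofReal_mul (by positivity), show 2 * x = 3 * (2 / 3 * x) by ring,
          Real.mul_rpow (by norm_num) hu.le, Real.rpow_neg hu.le]
        congr 1
        have : (2 / 3 * x) ^ s ≠ 0 := by positivity
        generalize (2 / 3 * x) ^ s = v at this
        field_simp

/-- The Carleson embedding `A^p → L^1((1 - t) ^ (-e) dμ)` for `p ≤ 1`. -/
theorem exists_lintegral_enorm_mul_le {μ : Measure UnitIco} {p e : ℝ} (hp0 : 0 < p) (hp1 : p ≤ 1)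
    (he : 0 ≤ e) (hμ : IsCarleson μ (2 / p + e)) :
    ∃ K : NNReal, ∀ f : ℂ → ℂ, DifferentiableOn ℂ f (Metric.ball 0 1) →
      ∫⁻ t : UnitIco, ‖f (t : ℝ)‖ₑ * ENNReal.ofReal ((1 - (t : ℝ)) ^ (-e)) ∂μ ≤
        K * bergmanNorm p f := by
  have := hμ.isFiniteMeasure
  obtain ⟨C, hC0, hC⟩ := hμ
  obtain ⟨K₁, hK₁⟩ := exists_enorm_rpow_le_lintegral_ball hp0 hp1
  obtain ⟨K₂, hK₂⟩ := exists_enorm_rpow_le hp0 hp1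
  -- `‖f‖ = ‖f‖ ^ p * (‖f‖ ^ p) ^ q`; local mean value bound on the first factor, growth on the second
  set q : ℝ := (1 - p) / p with hq
  have hq0 : 0 ≤ q := div_nonneg (by linarith) hp0.le
  have hpq : p + p * q = 1 := by rw [hq]; field_simp; ring
  have h1q : 1 + q = 1 / p := by rw [hq]; field_simp; ring
  set s := 2 / p + e with hs
  have hs0 : 0 ≤ s := by positivity
  refine ⟨K₁ * K₂ ^ q * ((C * 3 ^ s).toNNReal * Real.pi.toNNReal), fun f hf => ?_⟩
  rw [bergmanNorm_eq hp0]
  set N := ∫⁻ z, ‖f z‖ₑ ^ p ∂diskArea with hN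
  set g : ℂ → ENNReal := (Metric.ball 0 1).indicator (fun z => ‖f z‖ₑ ^ p) with hg
  have hgm : Measurable g := measurable_indicator_of_continuousOn
    (ENNReal.continuous_rpow_const.comp_continuousOn hf.continuousOn.enorm)
    Metric.isOpen_ball.measurableSet
  have hgN : ∫⁻ z, g z = ENNReal.ofReal Real.pi * N := by
    rw [hg, lintegral_indicator Metric.isOpen_ball.measurableSet, lintegral_ball_eq]
  set S : Set (UnitIco × ℂ) := {x | dist x.2 ((x.1 : ℝ) : ℂ) < (1 - (x.1 : ℝ)) / 2} with hS
  have hSm : MeasurableSet S := measurableSet_lt (by fun_prop) (by fun_prop)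
  set G : UnitIco → ℂ → ENNReal := fun t w =>
    S.indicator (fun x => ENNReal.ofReal ((1 - (x.1 : ℝ)) ^ (-s)) * g x.2) (t, w) with hG
  have hGm : Measurable (Function.uncurry G) :=
    Measurable.indicator (by fun_prop) hSm
  have hpt : ∀ t : UnitIco, ‖f (t : ℝ)‖ₑ * ENNReal.ofReal ((1 - (t : ℝ)) ^ (-e)) ≤
      K₁ * K₂ ^ q * N ^ q * ∫⁻ w, G t w := by
    intro t
    have hδ : 0 < 1 - (t : ℝ) := by linarith [t.2.2]
    have hGt : ∫⁻ w, G t w = ENNReal.ofReal ((1 - (t : ℝ)) ^ (-s)) *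
        ∫⁻ z in Metric.ball ((t : ℝ) : ℂ) ((1 - (t : ℝ)) / 2), ‖f z‖ₑ ^ p := by
      rw [← lintegral_const_mul' _ _ ENNReal.ofReal_ne_top,
        ← lintegral_indicator Metric.isOpen_ball.measurableSet]
      refine lintegral_congr fun w => ?_
      by_cases hw : w ∈ Metric.ball ((t : ℝ) : ℂ) ((1 - (t : ℝ)) / 2)
      · have hw1 : w ∈ Metric.ball (0 : ℂ) 1 := by
          refine Metric.ball_subset_ball' ?_ hw
          rw [dist_zero_right, Complex.norm_real, Real.norm_of_nonneg t.2.1]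
          linarith
        have hwS : (t, w) ∈ S := hw
        simp only [hG]
        rw [Set.indicator_of_mem hwS, Set.indicator_of_mem hw, hg, Set.indicator_of_mem hw1]
      · have hwS : (t, w) ∉ S := hw
        simp only [hG]
        rw [Set.indicator_of_notMem hwS, Set.indicator_of_notMem hw]
    have hpow : ENNReal.ofReal ((1 - (t : ℝ)) ^ (-s)) = ENNReal.ofReal ((1 - (t : ℝ)) ^ (-2 : ℝ)) *
        ENNReal.ofReal ((1 - (t : ℝ)) ^ (-2 : ℝ)) ^ q *
          ENNReal.ofReal ((1 - (t : ℝ)) ^ (-e)) := by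
      rw [ENNReal.ofReal_rpow_of_pos (by positivity), ← ENNReal.ofReal_mul (by positivity),
        ← ENNReal.ofReal_mul (by positivity), ← Real.rpow_mul hδ.le, ← Real.rpow_add hδ,
        ← Real.rpow_add hδ]
      congr 2
      rw [hs, show 2 / p = 2 * (1 / p) by ring, ← h1q]
      ring
    rw [hGt, hpow]
    calc ‖f (t : ℝ)‖ₑ * ENNReal.ofReal ((1 - (t : ℝ)) ^ (-e))
        = ‖f (t : ℝ)‖ₑ ^ p * (‖f (t : ℝ)‖ₑ ^ p) ^ q * ENNReal.ofReal ((1 - (t : ℝ)) ^ (-e)) := by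
          rw [← ENNReal.rpow_mul, ← ENNReal.rpow_add_of_nonneg _ _ hp0.le (by positivity), hpq,
            ENNReal.rpow_one]
      _ ≤ (K₁ * ENNReal.ofReal ((1 - (t : ℝ)) ^ (-2 : ℝ)) *
            ∫⁻ z in Metric.ball ((t : ℝ) : ℂ) ((1 - (t : ℝ)) / 2), ‖f z‖ₑ ^ p) *
          (K₂ * ENNReal.ofReal ((1 - (t : ℝ)) ^ (-2 : ℝ)) * N) ^ q *
            ENNReal.ofReal ((1 - (t : ℝ)) ^ (-e)) := by
          gcongr
          · exact hK₁ f hf t t.2.1 t.2.2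
          · exact hK₂ f hf t t.2.1 t.2.2
      _ = _ := by
          rw [ENNReal.mul_rpow_of_nonneg _ _ hq0, ENNReal.mul_rpow_of_nonneg _ _ hq0]
          ring
  calc ∫⁻ t : UnitIco, ‖f (t : ℝ)‖ₑ * ENNReal.ofReal ((1 - (t : ℝ)) ^ (-e)) ∂μ
      ≤ ∫⁻ t : UnitIco, K₁ * K₂ ^ q * N ^ q * (∫⁻ w : ℂ, G t w) ∂μ := lintegral_mono hpt
    _ = K₁ * K₂ ^ q * N ^ q * ∫⁻ w, ∫⁻ t, G t w ∂μ := by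
        rw [lintegral_const_mul _ hGm.lintegral_prod_right,
          lintegral_lintegral_swap hGm.aemeasurable]
    _ ≤ K₁ * K₂ ^ q * N ^ q * ∫⁻ w, ENNReal.ofReal (C * 3 ^ s) * g w := by
        gcongr with w
        by_cases hw : w ∈ Metric.ball (0 : ℂ) 1
        · have hm : MeasurableSet {t : UnitIco | dist w ((t : ℝ) : ℂ) < (1 - (t : ℝ)) / 2} :=
            measurableSet_lt (by fun_prop) (by fun_prop)
          have e1 : ∀ t : UnitIco, G t w =
              {t : UnitIco | dist w ((t : ℝ) : ℂ) < (1 - (t : ℝ)) / 2}.indicator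
                (fun t : UnitIco => ENNReal.ofReal ((1 - (t : ℝ)) ^ (-s)) * g w) t := fun t => rfl
          simp_rw [e1]
          rw [lintegral_indicator hm, lintegral_mul_const _ (by fun_prop)]
          gcongr
          exact lintegral_rpow_neg_tent_le hs0 hC0 hC (mem_ball_zero_iff.1 hw)
        · have e1 : ∀ t : UnitIco, G t w = 0 := fun t => by
            simp only [hG, hg]
            rw [Set.indicator_apply_eq_zero]
            intro _
            rw [Set.indicator_of_notMem hw, mul_zero]
          simp [e1]
    _ = _ := by
        rw [lintegral_const_mul _ hgm, hgN, ← h1q, ENNReal.rpow_add_of_nonneg _ _ zero_le_one hq0,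
          ENNReal.rpow_one, ENNReal.coe_mul, ENNReal.coe_mul, ENNReal.coe_mul,
          ENNReal.coe_rpow_of_nonneg _ hq0, ENNReal.ofReal, ENNReal.ofReal]
        ring

/-! ### Sufficiency of the Carleson condition -/

theorem one_sub_norm_le {t : ℝ} (ht0 : 0 ≤ t) (ht1 : t ≤ 1) (z : ℂ) :
    1 - ‖z‖ ≤ ‖1 - (t : ℂ) * z‖ := by
  have := norm_sub_norm_le (1 : ℂ) ((t : ℂ) * z)
  rw [norm_one, norm_mul, Complex.norm_real, Real.norm_of_nonneg ht0] at this
  nlinarith [norm_nonneg z]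

theorem one_sub_mul_mem_slitPlane {t : ℝ} (ht0 : 0 ≤ t) (ht1 : t ≤ 1) {z : ℂ} (hz : ‖z‖ < 1) :
    1 - (t : ℂ) * z ∈ Complex.slitPlane := by
  rw [Complex.mem_slitPlane_iff]
  left
  have := Complex.re_le_norm z
  have := norm_nonneg z
  simp only [Complex.sub_re, Complex.one_re, Complex.re_ofReal_mul]
  nlinarith

theorem enorm_hilbertIntegrand (α : ℝ) (f : ℂ → ℂ) (z : ℂ) (t : UnitIco) :
    ‖hilbertIntegrand α f z t‖ₑ =
      ‖f (t : ℝ)‖ₑ * ENNReal.ofReal (‖1 - ((t : ℝ) : ℂ) * z‖ ^ (-(α + 1))) := by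
  rw [← ofReal_norm, ← ofReal_norm, ← ENNReal.ofReal_mul (norm_nonneg _), hilbertIntegrand,
    norm_div, Complex.norm_cpow_real, Real.rpow_neg (norm_nonneg _), div_eq_mul_inv]

theorem continuous_restrict_unitIco {f : ℂ → ℂ} (hf : DifferentiableOn ℂ f (Metric.ball 0 1)) :
    Continuous fun t : UnitIco => f ((t : ℝ) : ℂ) := by
  refine hf.continuousOn.comp_continuous (by fun_prop) fun t => ?_
  rw [mem_ball_zero_iff, Complex.norm_real, Real.norm_of_nonneg t.2.1]
  exact t.2.2

theorem measurable_hilbertIntegrand {α : ℝ} {f : ℂ → ℂ}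
    (hf : DifferentiableOn ℂ f (Metric.ball 0 1)) (z : ℂ) :
    Measurable (hilbertIntegrand α f z) := by
  exact (continuous_restrict_unitIco hf).measurable.div (by fun_prop)

theorem integrable_hilbertIntegrand {μ : Measure UnitIco} {α : ℝ} (hα : -1 < α) {f : ℂ → ℂ}
    (hf : DifferentiableOn ℂ f (Metric.ball 0 1))
    (hint : Integrable (fun t : UnitIco => f ((t : ℝ) : ℂ)) μ) {z : ℂ} (hz : ‖z‖ < 1) :
    Integrable (hilbertIntegrand α f z) μ := by
  refine (hint.norm.mul_const ((1 - ‖z‖) ^ (-(α + 1)))).mono'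
    (measurable_hilbertIntegrand hf z).aestronglyMeasurable (Filter.Eventually.of_forall fun t => ?_)
  rw [hilbertIntegrand, norm_div, Complex.norm_cpow_real, div_eq_mul_inv,
    ← Real.rpow_neg (norm_nonneg _)]
  gcongr ?_ * ?_
  exact Real.rpow_le_rpow_of_nonpos (by linarith) (one_sub_norm_le t.2.1 t.2.2.le z) (by linarith)

/-- Differentiation under the integral sign; on a ball around `z₀` whose closure is in the disc, the
derivative of the kernel is bounded uniformly in `t`. -/
theorem differentiableOn_hilbertOp {μ : Measure UnitIco} {α : ℝ} (hα : -1 < α) {f : ℂ → ℂ}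
    (hf : DifferentiableOn ℂ f (Metric.ball 0 1))
    (hint : Integrable (fun t : UnitIco => f ((t : ℝ) : ℂ)) μ) :
    DifferentiableOn ℂ (hilbertOp μ α f) (Metric.ball 0 1) := by
  intro z₀ hz₀
  rw [mem_ball_zero_iff] at hz₀
  set ε := (1 - ‖z₀‖) / 2 with hε
  have hε0 : 0 < ε := by rw [hε]; linarith
  have hball : ∀ z ∈ Metric.ball z₀ ε, ‖z‖ < 1 ∧ ε ≤ 1 - ‖z‖ := by
    intro z hz
    have h1 : ‖z‖ ≤ ‖z - z₀‖ + ‖z₀‖ := by simpa using norm_add_le (z - z₀) z₀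
    rw [mem_ball_iff_norm] at hz
    constructor <;> linarith
  set c : ℂ := ((-(α + 1) : ℝ) : ℂ) with hc
  set F' : ℂ → UnitIco → ℂ := fun z t =>
    f ((t : ℝ) : ℂ) * (c * (1 - ((t : ℝ) : ℂ) * z) ^ (c - 1) * (-((t : ℝ) : ℂ))) with hF'
  have hm := (continuous_restrict_unitIco hf).measurable
  refine (hasDerivAt_integral_of_dominated_loc_of_deriv_le (F := hilbertIntegrand α f) (F' := F')
    (bound := fun t : UnitIco => ‖f ((t : ℝ) : ℂ)‖ * ((α + 1) * ε ^ (-(α + 1) - 1)))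
    (Metric.ball_mem_nhds z₀ hε0)
    (Filter.Eventually.of_forall fun z => (measurable_hilbertIntegrand hf z).aestronglyMeasurable)
    (integrable_hilbertIntegrand hα hf hint hz₀) ?_ ?_ (hint.norm.mul_const _)
    ?_).2.differentiableAt.differentiableWithinAt
  · apply Measurable.aestronglyMeasurable
    exact hm.mul (by fun_prop)
  · refine Filter.Eventually.of_forall fun t z hz => ?_
    obtain ⟨hz1, hz2⟩ := hball z hz
    have hcn : ‖c‖ = α + 1 := by
      rw [hc, Complex.norm_real, Real.norm_eq_abs, abs_neg, abs_of_pos (by linarith)]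
    have hc1 : c - 1 = ((-(α + 1) - 1 : ℝ) : ℂ) := by rw [hc]; push_cast; ring
    have ht : ‖-(((t : ℝ) : ℂ))‖ ≤ 1 := by
      rw [norm_neg, Complex.norm_real, Real.norm_of_nonneg t.2.1]
      exact t.2.2.le
    simp only [hF']
    rw [norm_mul, norm_mul, norm_mul, hcn, hc1, Complex.norm_cpow_real]
    refine mul_le_mul_of_nonneg_left ?_ (norm_nonneg _)
    have hle : ‖1 - ((t : ℝ) : ℂ) * z‖ ^ (-(α + 1) - 1) ≤ ε ^ (-(α + 1) - 1) :=
      Real.rpow_le_rpow_of_nonpos hε0 (hz2.trans (one_sub_norm_le t.2.1 t.2.2.le z)) (by linarith)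
    calc (α + 1) * ‖1 - ((t : ℝ) : ℂ) * z‖ ^ (-(α + 1) - 1) * ‖-(((t : ℝ) : ℂ))‖
        ≤ (α + 1) * ε ^ (-(α + 1) - 1) * 1 := by
          have : 0 ≤ α + 1 := by linarith
          gcongr
      _ = _ := mul_one _
  · refine Filter.Eventually.of_forall fun t z hz => ?_
    have h1 : HasDerivAt (fun z : ℂ => 1 - ((t : ℝ) : ℂ) * z) (-((t : ℝ) : ℂ)) z := by
      simpa using ((hasDerivAt_id z).const_mul ((t : ℝ) : ℂ)).const_sub 1
    have h2 := (h1.cpow_const (c := c)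
      (one_sub_mul_mem_slitPlane t.2.1 t.2.2.le (hball z hz).1)).const_mul (f ((t : ℝ) : ℂ))
    convert! h2 using 1
    ext w
    rw [hilbertIntegrand, hc, Complex.ofReal_neg, Complex.cpow_neg, div_eq_mul_inv]

/-- The triangle inequality followed by Tonelli. -/
theorem lintegral_enorm_hilbertOp_le {μ : Measure UnitIco} [SFinite μ] {α : ℝ} {f : ℂ → ℂ}
    (hf : DifferentiableOn ℂ f (Metric.ball 0 1)) :
    ∫⁻ z, ‖hilbertOp μ α f z‖ₑ ∂diskArea ≤ ∫⁻ t : UnitIco, ‖f ((t : ℝ) : ℂ)‖ₑ *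
      ∫⁻ z, ENNReal.ofReal (‖1 - ((t : ℝ) : ℂ) * z‖ ^ (-(α + 1))) ∂diskArea ∂μ := by
  have hm := (continuous_restrict_unitIco hf).measurable
  have : SFinite diskArea := by unfold diskArea; infer_instance
  calc ∫⁻ z, ‖hilbertOp μ α f z‖ₑ ∂diskArea
      ≤ ∫⁻ z, ∫⁻ t, ‖hilbertIntegrand α f z t‖ₑ ∂μ ∂diskArea :=
        lintegral_mono fun z => enorm_integral_le_lintegral_enorm _
    _ = ∫⁻ t, ∫⁻ z, ‖hilbertIntegrand α f z t‖ₑ ∂diskArea ∂μ := by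
        refine lintegral_lintegral_swap (Measurable.aemeasurable ?_)
        simp only [enorm_hilbertIntegrand, Function.uncurry_def]
        exact (hm.comp measurable_snd).enorm.mul (by fun_prop)
    _ = _ := by
        refine lintegral_congr fun t => ?_
        simp_rw [enorm_hilbertIntegrand]
        rw [lintegral_const_mul' _ _ enorm_ne_top]

theorem IsCarleson.hilbertOpBounded {μ : Measure UnitIco} {p α : ℝ} (hp0 : 0 < p) (hp1 : p ≤ 1)
    (hα : -1 < α) (hα1 : α ≠ 1) (hμ : IsCarleson μ (2 / p + max (α - 1) 0)) :
    HilbertOpBounded μ α p 1 := by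
  have := hμ.isFiniteMeasure
  obtain ⟨K, hK⟩ := exists_lintegral_enorm_mul_le hp0 hp1 (le_max_right _ _) hμ
  obtain ⟨C, hC⟩ := exists_lintegral_kernel_le hα hα1
  have hnorm : ∀ f : ℂ → ℂ, MemBergman p f →
      bergmanNorm 1 (hilbertOp μ α f) ≤ (C * K : NNReal) * bergmanNorm p f := by
    intro f hf
    rw [bergmanNorm_one]
    calc ∫⁻ z, ‖hilbertOp μ α f z‖ₑ ∂diskArea
        ≤ ∫⁻ t : UnitIco, ‖f ((t : ℝ) : ℂ)‖ₑ *
          ∫⁻ z, ENNReal.ofReal (‖1 - ((t : ℝ) : ℂ) * z‖ ^ (-(α + 1))) ∂diskArea ∂μ :=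
          lintegral_enorm_hilbertOp_le hf.1
      _ ≤ ∫⁻ t : UnitIco, C * (‖f ((t : ℝ) : ℂ)‖ₑ *
          ENNReal.ofReal ((1 - (t : ℝ)) ^ (-max (α - 1) 0))) ∂μ := by
          refine lintegral_mono fun t => ?_
          rw [mul_left_comm]
          gcongr
          exact hC t t.2.1 t.2.2
      _ = C * ∫⁻ t : UnitIco, ‖f ((t : ℝ) : ℂ)‖ₑ *
          ENNReal.ofReal ((1 - (t : ℝ)) ^ (-max (α - 1) 0)) ∂μ :=
          lintegral_const_mul' _ _ ENNReal.coe_ne_top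
      _ ≤ C * (K * bergmanNorm p f) := by gcongr; exact hK f hf.1
      _ = _ := by rw [ENNReal.coe_mul, mul_assoc]
  refine ⟨fun f hf => ?_, C * K, hnorm⟩
  -- `(1 - t) ^ (-e) ≥ 1`, so the weighted embedding controls the unweighted integral
  have hint : Integrable (fun t : UnitIco => f ((t : ℝ) : ℂ)) μ := by
    refine ⟨(continuous_restrict_unitIco hf.1).measurable.aestronglyMeasurable, ?_⟩
    refine lt_of_le_of_lt (lintegral_mono fun t => ?_)
      ((hK f hf.1).trans_lt (ENNReal.mul_lt_top ENNReal.coe_lt_top hf.2))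
    refine le_mul_of_one_le_right' (ENNReal.one_le_ofReal.2 ?_)
    exact Real.one_le_rpow_of_pos_of_le_one_of_nonpos (by linarith [t.2.2]) (by linarith [t.2.1])
      (neg_nonpos.2 (le_max_right _ _))
  exact ⟨fun z hz => integrable_hilbertIntegrand hα hf.1 hint (mem_ball_zero_iff.1 hz),
    differentiableOn_hilbertOp hα hf.1 hint,
    (hnorm f hf).trans_lt (ENNReal.mul_lt_top ENNReal.coe_lt_top hf.2)⟩

/-! ### Necessity of the Carleson condition -/

/-- The test function `z ↦ (1 - b z)⁻ᵏ`, with a natural exponent so that no branch is involved. -/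
noncomputable def kernelPow (k : ℕ) (b : ℝ) (z : ℂ) : ℂ := ((1 - (b : ℂ) * z) ^ k)⁻¹

theorem differentiableOn_kernelPow (k : ℕ) {b : ℝ} (hb0 : 0 ≤ b) (hb1 : b < 1) :
    DifferentiableOn ℂ (kernelPow k b) (Metric.ball 0 1) := by
  unfold kernelPow
  refine DifferentiableOn.fun_inv (by fun_prop) fun z hz => pow_ne_zero k ?_
  exact Complex.slitPlane_ne_zero
    (one_sub_mul_mem_slitPlane hb0 hb1.le (mem_ball_zero_iff.1 hz))

theorem exists_bergmanNorm_kernelPow_le {p : ℝ} (hp : 0 < p) {k : ℕ} (hk : 2 < k * p) :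
    ∃ C : NNReal, ∀ b : ℝ, 0 ≤ b → b < 1 →
      bergmanNorm p (kernelPow k b) ≤ C * ENNReal.ofReal ((1 - b) ^ (2 / p - k)) := by
  obtain ⟨C, hC⟩ := exists_lintegral_kernel_le_of_two_lt hk
  refine ⟨C ^ (1 / p), fun b hb0 hb1 => ?_⟩
  have e : ∀ z, ‖kernelPow k b z‖ₑ ^ p = ENNReal.ofReal (‖1 - (b : ℂ) * z‖ ^ (-(k * p))) := by
    intro z
    rw [← ofReal_norm, ENNReal.ofReal_rpow_of_nonneg (norm_nonneg _) hp.le, kernelPow, norm_inv,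
      norm_pow, Real.inv_rpow (by positivity), ← Real.rpow_natCast,
      ← Real.rpow_mul (norm_nonneg _), Real.rpow_neg (norm_nonneg _)]
  rw [bergmanNorm_eq hp]
  simp_rw [e]
  have hδ : 0 < 1 - b := by linarith
  calc _ ≤ (C * ENNReal.ofReal ((1 - b) ^ (2 - k * p))) ^ (1 / p) := by
        gcongr; exact hC b hb0 hb1
    _ = _ := by
        rw [ENNReal.mul_rpow_of_nonneg _ _ (by positivity), ENNReal.ofReal_rpow_of_pos
          (by positivity), ← Real.rpow_mul hδ.le, ENNReal.coe_rpow_of_nonneg _ (by positivity)]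
        congr 3
        field_simp

theorem hilbertIntegrand_kernelPow (α : ℝ) (k : ℕ) {b c : ℝ} (hc0 : 0 ≤ c) (hc : c ≤ 1)
    (t : UnitIco) :
    hilbertIntegrand α (kernelPow k b) c t =
      ((((1 - b * t) ^ k)⁻¹ * ((1 - t * c) ^ (α + 1))⁻¹ : ℝ) : ℂ) := by
  have : 0 ≤ 1 - t * c := by nlinarith [t.2.1, t.2.2]
  rw [hilbertIntegrand, kernelPow, Complex.ofReal_mul, Complex.ofReal_inv, Complex.ofReal_inv,
    Complex.ofReal_cpow this, div_eq_mul_inv]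
  push_cast
  rfl

/-- On `[0, 1)` the integrand is a nonnegative real number, and for `t ≥ b ≥ c` it is at least the
constant on the left. -/
theorem measure_mul_le_enorm_hilbertOp {μ : Measure UnitIco} {α : ℝ} (hα : -1 < α) (k : ℕ)
    {b c : ℝ} (hc0 : 0 ≤ c) (hcb : c ≤ b) (hb1 : b < 1)
    (hint : Integrable (hilbertIntegrand α (kernelPow k b) c) μ) :
    ENNReal.ofReal (((2 * (1 - b)) ^ k)⁻¹ * ((2 * (1 - c)) ^ (α + 1))⁻¹) *
        μ (Set.Ici ⟨b, hc0.trans hcb, hb1⟩) ≤ ‖hilbertOp μ α (kernelPow k b) c‖ₑ := by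
  have hb0 := hc0.trans hcb
  have hc1 := hcb.trans_lt hb1
  set g : UnitIco → ℝ := fun t => ((1 - b * t) ^ k)⁻¹ * ((1 - t * c) ^ (α + 1))⁻¹ with hg
  have e : hilbertIntegrand α (kernelPow k b) c = fun t => (g t : ℂ) :=
    funext fun t => hilbertIntegrand_kernelPow α k hc0 hc1.le t
  have hpos : ∀ t : UnitIco, 0 < 1 - b * t ∧ 0 < 1 - t * c := fun t => by
    have h0 := t.2.1
    have h1 := t.2.2
    constructor <;> nlinarith
  have hg0 : ∀ t, 0 ≤ g t := fun t => by
    have := hpos t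
    have h1 := this.1
    have h2 := this.2
    positivity
  rw [e] at hint
  have hgint : Integrable g μ := by simpa using hint.re
  rw [hilbertOp, e, integral_complex_ofReal, ← ofReal_norm, Complex.norm_real,
    Real.norm_of_nonneg (integral_nonneg hg0),
    ofReal_integral_eq_lintegral_ofReal hgint (Filter.Eventually.of_forall hg0), ← setLIntegral_const]
  refine (setLIntegral_mono' measurableSet_Ici fun t ht => ?_).trans (setLIntegral_le_lintegral _ _)
  have htb : b ≤ t := ht
  have h1 := t.2.2
  obtain ⟨hp1, hp2⟩ := hpos t
  have hα' : 0 ≤ α + 1 := by linarith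
  apply ENNReal.ofReal_le_ofReal
  simp only [hg]
  gcongr
  · nlinarith
  · nlinarith

/-- Boundedness on the test functions gives one inequality in two parameters: the exponent `k`
cancels, and the free point `c ≤ b` at which the image is evaluated trades off the weight. -/
theorem HilbertOpBounded.exists_measure_le {μ : Measure UnitIco} {p α : ℝ} (hp0 : 0 < p)
    (hα : -1 < α) (h : HilbertOpBounded μ α p 1) :
    ∃ C : ℝ, 0 < C ∧ ∀ (b c : ℝ) (hc0 : 0 ≤ c) (hcb : c ≤ b) (hb1 : b < 1),
      μ (Set.Ici ⟨b, hc0.trans hcb, hb1⟩) ≤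
        ENNReal.ofReal (C * ((1 - b) ^ (2 / p) * (1 - c) ^ (α - 1))) := by
  obtain ⟨k, hk⟩ := exists_nat_gt (2 / p)
  rw [div_lt_iff₀ hp0] at hk
  obtain ⟨C₁, hC₁⟩ := exists_bergmanNorm_kernelPow_le hp0 hk
  obtain ⟨hmem, C₂, hC₂⟩ := h
  obtain ⟨K, hK⟩ := exists_enorm_rpow_le one_pos le_rfl
  -- the summand `1` only makes the constant positive
  refine ⟨2 ^ k * 2 ^ (α + 1) * (K * C₂ * C₁ + 1), by positivity, fun b c hc0 hcb hb1 => ?_⟩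
  have hb0 := hc0.trans hcb
  have hc1 := hcb.trans_lt hb1
  have hδ : 0 < 1 - b := by linarith
  have hδc : 0 < 1 - c := by linarith
  have hf : MemBergman p (kernelPow k b) := ⟨differentiableOn_kernelPow k hb0 hb1,
    (hC₁ b hb0 hb1).trans_lt (ENNReal.mul_lt_top ENNReal.coe_lt_top ENNReal.ofReal_lt_top)⟩
  have hcball : (c : ℂ) ∈ Metric.ball (0 : ℂ) 1 := by
    rwa [mem_ball_zero_iff, Complex.norm_real, Real.norm_of_nonneg hc0]
  obtain ⟨hint, hF⟩ := hmem _ hf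
  have hlow := measure_mul_le_enorm_hilbertOp hα k hc0 hcb hb1 (hint c hcball)
  have hup : ‖hilbertOp μ α (kernelPow k b) c‖ₑ ≤
      ENNReal.ofReal (K * C₂ * C₁ * ((1 - c) ^ (-2 : ℝ) * (1 - b) ^ (2 / p - k))) := by
    have h1 := hK _ hF.1 c hc0 hc1
    simp only [ENNReal.rpow_one, ← bergmanNorm_one] at h1
    calc _ ≤ K * ENNReal.ofReal ((1 - c) ^ (-2 : ℝ)) *
          bergmanNorm 1 (hilbertOp μ α (kernelPow k b)) := h1
      _ ≤ K * ENNReal.ofReal ((1 - c) ^ (-2 : ℝ)) *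
          (C₂ * (C₁ * ENNReal.ofReal ((1 - b) ^ (2 / p - k)))) := by
          gcongr
          exact (hC₂ _ hf).trans (by gcongr; exact hC₁ b hb0 hb1)
      _ = _ := by
          rw [ENNReal.ofReal_mul (by positivity), ENNReal.ofReal_mul (by positivity),
            ENNReal.ofReal_mul (by positivity), ENNReal.ofReal_mul (by positivity),
            ENNReal.ofReal_coe_nnreal, ENNReal.ofReal_coe_nnreal, ENNReal.ofReal_coe_nnreal]
          ring
  set m := μ (Set.Ici ⟨b, hc0.trans hcb, hb1⟩)
  have hA : 0 < (2 * (1 - b)) ^ k * (2 * (1 - c)) ^ (α + 1) := by positivity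
  have e1 : ENNReal.ofReal ((2 * (1 - b)) ^ k * (2 * (1 - c)) ^ (α + 1)) *
      ENNReal.ofReal (((2 * (1 - b)) ^ k)⁻¹ * ((2 * (1 - c)) ^ (α + 1))⁻¹) = 1 := by
    rw [← ENNReal.ofReal_mul hA.le, ← mul_inv, mul_inv_cancel₀ hA.ne', ENNReal.ofReal_one]
  calc m = ENNReal.ofReal ((2 * (1 - b)) ^ k * (2 * (1 - c)) ^ (α + 1)) *
      (ENNReal.ofReal (((2 * (1 - b)) ^ k)⁻¹ * ((2 * (1 - c)) ^ (α + 1))⁻¹) * m) := by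
        rw [← mul_assoc, e1, one_mul]
    _ ≤ ENNReal.ofReal ((2 * (1 - b)) ^ k * (2 * (1 - c)) ^ (α + 1)) *
        ENNReal.ofReal (K * C₂ * C₁ * ((1 - c) ^ (-2 : ℝ) * (1 - b) ^ (2 / p - k))) := by
        gcongr
        exact hlow.trans hup
    _ = ENNReal.ofReal (2 ^ k * 2 ^ (α + 1) * (K * C₂ * C₁) *
        ((1 - b) ^ (2 / p) * (1 - c) ^ (α - 1))) := by
        rw [← ENNReal.ofReal_mul hA.le]
        congr 1
        have e2 : (1 - b) ^ (2 / p) = (1 - b) ^ k * (1 - b) ^ (2 / p - k) := by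
          rw [← Real.rpow_natCast, ← Real.rpow_add hδ]; congr 1; ring
        have e3 : (1 - c) ^ (α - 1) = (1 - c) ^ (α + 1) * (1 - c) ^ (-2 : ℝ) := by
          rw [← Real.rpow_add hδc]; congr 1; ring
        rw [e2, e3, mul_pow, Real.mul_rpow (by norm_num) hδc.le]
        ring
    _ ≤ _ := by
        apply ENNReal.ofReal_le_ofReal
        gcongr
        linarith

theorem theorem4p1 (μ : MeasureTheory.Measure UnitIco) (p : ℝ) (hp0 : 0 < p) (hp1 : p ≤ 1) :
    (∀ α : ℝ, 1 < α →
      (HilbertOpBounded μ α p 1 ↔ IsCarleson μ (2 / p + α - 1))) ∧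
    (∀ α : ℝ, -1 < α → α < 1 →
      (HilbertOpBounded μ α p 1 ↔ IsCarleson μ (2 / p))) := by
  refine ⟨fun α hα => ⟨fun h => ?_, fun h => ?_⟩, fun α hα hα1 => ⟨fun h => ?_, fun h => ?_⟩⟩
  · -- evaluate at `c = b`
    obtain ⟨C, hC0, hC⟩ := h.exists_measure_le hp0 (by linarith)
    refine ⟨C, hC0, fun t => (hC t t t.2.1 le_rfl t.2.2).trans_eq ?_⟩
    rw [← Real.rpow_add (by linarith [t.2.2]), add_sub_assoc]
  · refine IsCarleson.hilbertOpBounded hp0 hp1 (by linarith) hα.ne' ?_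
    rwa [max_eq_left (by linarith), ← add_sub_assoc]
  · -- evaluate at `c = 0`
    obtain ⟨C, hC0, hC⟩ := h.exists_measure_le hp0 hα
    refine ⟨C, hC0, fun t => (hC t 0 le_rfl t.2.1 t.2.2).trans_eq ?_⟩
    simp
  · refine IsCarleson.hilbertOpBounded hp0 hp1 hα hα1.ne ?_
    rwa [max_eq_right (by linarith), add_zero]
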